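/- Let $n\ge 2$, $k\ge 2$ be integers. Let $\mathcal M_k$ be the set of matrices $M\in[0,1]^{n\times n}$ such that $M_{ii}=0$ for all $i\in[n]$ and $M_{ij}=M_{ji}=Q_{z_iz_j}$ for all $i\ne j$, for some symmetric $Q\in[0,1]^{k\times k}$ and some $z\in[k]^n$. Given $M\in\mathcal M_k$, let $A\in\{0,1\}^{n\times n}$ be the random symmetric adjacency matrix with $A_{ii}=0$ and with $A_{ij}=A_{ji}\sim\mathrm{Bern}(M_{ij})$ independent over $1\le i<j\le n$, and write $\mathbb E$ for the expectation over $A$. Let $$\ell(\widehat M,M)=\binom n2^{-1}\sum_{1\le i<j\le n}(\widehat M_{ij}-M_{ij})^2 .$$ For an integer $D\ge 1$ let $\mathbb R[A]^{n\times n}_{\le D}$ be the set of estimators $\widehat M=\widehat M(A)$ each of whose entries $\widehat M_{ij}$ is a real polynomial of degree at most $D$ in the entries of $A$. There is a universal constant $c>0$ (not depending on $n$, $k$ or $D$) such that, for all integers $n\ge 2$, $k\ge 2$ and $D\ge 1$, $$\inf_{\widehat M\in\mathbb R[A]^{n\times n}_{\le D}}\ \sup_{M\in\mathcal M_k}\ \mathbb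 E\big(\ell(\widehat M,M)\big)\ \ge\ \frac{c}{D^4}\Big(\frac kn\wedge\frac1k\Big).$$ In particular, if $2\le k\le\sqrt n$, then $$\inf_{\widehat M\in\mathbb R[A]^{n\times n}_{\le D}}\ \sup_{M\in\mathcal M_k}\ \mathbb E\big(\ell(\widehat M,M)\big)\ \ge\ \frac{ck}{nD^4}.$$ -/

import Mathlib

open MeasureTheory ProbabilityTheory
open scoped ENNReal

noncomputable section

namespace Graphon

/-- The unordered pairs of distinct vertices of `[n]`, written as pairs `(i, j)` with `i < j`. -/
abbrev EdgeIdx (n : ℕ) : Type := {e : Fin n × Fin n // e.1 < e.2}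

/-- The class of connectivity probability matrices of stochastic block models with `n` vertices and
`k` communities: matrices with entries in `[0,1]`, zero diagonal, and `M i j = Q (z i) (z j)` off
the diagonal for some symmetric `Q` with entries in `[0,1]` and some label vector `z`.
(No label is required to be used.) -/
def sbmClass (n k : ℕ) : Set (Matrix (Fin n) (Fin n) unitInterval) :=
  {M | (∀ i, M i i = 0) ∧
    ∃ (Q : Matrix (Fin k) (Fin k) unitInterval) (z : Fin n → Fin k),
      Q.IsSymm ∧ ∀ i j, i ≠ j → M i j = Q (z i) (z j)}

/-- The joint law of the edge indicators: independent over `i < j`, and the one of `(i, j)` is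
Bernoulli with parameter `M i j`. -/
def edgeLaw {n : ℕ} (M : Matrix (Fin n) (Fin n) unitInterval) : Measure (EdgeIdx n → Bool) :=
  Measure.pi fun e => bernoulliMeasure true false (M e.1.1 e.1.2)

/-- The adjacency matrix (symmetric, with zero diagonal and entries in `{0,1}`) of the graph with
the given edge indicators. -/
def adjacency {n : ℕ} (x : EdgeIdx n → Bool) : Matrix (Fin n) (Fin n) ℝ := fun i j =>
  if h : i < j then (if x ⟨(i, j), h⟩ then 1 else 0)
  else if h : j < i then (if x ⟨(j, i), h⟩ then 1 else 0)
  else 0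

/-- The estimators all of whose entries are polynomials of degree at most `D` in the entries of the
observed adjacency matrix. The variable `(a, b)` stands for the entry `A a b`. -/
def polyEstimators (n D : ℕ) :
    Set (Matrix (Fin n) (Fin n) (MvPolynomial (Fin n × Fin n) ℝ)) :=
  {P | ∀ i j, (P i j).totalDegree ≤ D}

/-- The value of a polynomial estimator at the data `A`. -/
def evalEstimator {n : ℕ} (P : Matrix (Fin n) (Fin n) (MvPolynomial (Fin n × Fin n) ℝ))
    (A : Matrix (Fin n) (Fin n) ℝ) : Matrix (Fin n) (Fin n) ℝ := fun i j =>
  MvPolynomial.eval (fun e => A e.1 e.2) (P i j)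

/-- The mean squared error over the pairs `i < j`. -/
def loss {n : ℕ} (Mhat : Matrix (Fin n) (Fin n) ℝ)
    (M : Matrix (Fin n) (Fin n) unitInterval) : ℝ :=
  (1 / (n.choose 2 : ℝ)) * ∑ e : EdgeIdx n, (Mhat e.1.1 e.1.2 - (M e.1.1 e.1.2 : ℝ)) ^ 2

/-- The expected loss of the estimator `P` when the graph is drawn with connectivity
probabilities `M`. -/
def risk {n : ℕ} (P : Matrix (Fin n) (Fin n) (MvPolynomial (Fin n × Fin n) ℝ))
    (M : Matrix (Fin n) (Fin n) unitInterval) : ℝ≥0∞ :=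
  ∫⁻ x, ENNReal.ofReal (loss (evalEstimator P (adjacency x)) M) ∂(edgeLaw M)

/-- The minimax risk over the stochastic block model class with `k` communities among estimators
with entries of degree at most `D`. -/
def lowDegreeMinimaxRisk (n k D : ℕ) : ℝ≥0∞ :=
  ⨅ P ∈ polyEstimators n D, ⨆ M ∈ sbmClass n k, risk P M

end Graphon

end

/-!
The minimax risk is bounded below by the Bayes risk for a random member of the class: the labels
`z` are independent and uniform among `m ≤ k` labels, and an edge `e` is present with probability
`(1 + lam X_e) / 2`, where `X_e` is the indicator that its endpoints have the same label. The
strength is `lam² ≍ m² / (n D⁴)`, so the signal `lam X_e / 2` has variance of order `m / (n D⁴)`.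
What has to be shown is that polynomials of degree `D` in the data hardly correlate with `X_{e₀}`.

Optimality is certified by duality (`bayes_risk_ge`). Couple the signs `y_e` of the data with
uniform signs `s_e` independent of the labels: with probability `1 - lam` they agree, otherwise
`y_e` is redrawn with mean `X_e` (`coupling`). If a function `W` of `s` has the same correlation as
`X_{e₀}` with every function of `y` of degree at most `D`, then expanding the squares gives
`𝔼 (f - X_{e₀})² = 𝔼 (f - W)² + 𝔼 X_{e₀}² - 𝔼 W²`, hence a lower bound uniform in `f`. Solving the
triangular system for the Walsh coefficients of `W` gives
`(lam / (1 - lam)) ^ #T * κ T` for `#T ≤ D`, where `κ T` is the joint cumulant of `X_{e₀}` and the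
`X_e`, `e ∈ T` (`cumulant`, `jointExp_mul_certificate`).

It remains to see that `𝔼 W² = ∑ (lam / (1 - lam)) ^ (2 #T) (κ T)²` is at most `(4 / 3) m⁻²`, against
`𝔼 X_{e₀}² = m⁻¹` (`sum_sq_cumulant_le`). Two facts on `κ T` are used. It vanishes unless `T` is
connected to `e₀`, because vertex-disjoint edge sets are independent
(`mem_grown_of_cumulant_ne_zero`). And `|κ T| ≤ (4 D) ^ #T * p`, where `p` is the probability that
all edges of `insert e₀ T` are monochromatic, because such events are positively correlated
(`abs_cumulant_le`). Building connected sets edge by edge, a new vertex costs a factor `n` in the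
number of sets and gains a factor `m⁻²` in `p²`, so each edge contributes
`O(D² n / m²)` (`sum_grown_le`); together with `lam² (4 D)²` this is a small constant per edge, and
the sum over `#T` is geometric.
-/

namespace Graphon

/-! ### Monochromatic labellings -/

section Monochromatic

variable {n : ℕ} (L : Type*) [Fintype L] [DecidableEq L]

/-- The labellings of the vertices by `L` that are constant along every edge of `S`. -/
def monoLabellings (S : Finset (EdgeIdx n)) : Finset (Fin n → L) :=
  {z | ∀ e ∈ S, z e.1.1 = z e.1.2}

/-- The probability that every edge of `S` is monochromatic when the labels of the vertices are
independent and uniform in `L`. -/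
noncomputable def monoProb (S : Finset (EdgeIdx n)) : ℝ :=
  (monoLabellings L S).card / (Fintype.card L : ℝ) ^ n

/-- The set of endpoints of the edges of `S`. -/
def verts (S : Finset (EdgeIdx n)) : Finset (Fin n) :=
  S.biUnion fun e => {e.1.1, e.1.2}

variable {L}

@[simp] lemma mem_monoLabellings {S : Finset (EdgeIdx n)} {z : Fin n → L} :
    z ∈ monoLabellings L S ↔ ∀ e ∈ S, z e.1.1 = z e.1.2 := by
  simp [monoLabellings]

lemma mem_verts {S : Finset (EdgeIdx n)} {i : Fin n} :
    i ∈ verts S ↔ ∃ e ∈ S, i = e.1.1 ∨ i = e.1.2 := by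
  simp [verts]

lemma fst_mem_verts {S : Finset (EdgeIdx n)} {e : EdgeIdx n} (he : e ∈ S) : e.1.1 ∈ verts S :=
  mem_verts.2 ⟨e, he, Or.inl rfl⟩

lemma snd_mem_verts {S : Finset (EdgeIdx n)} {e : EdgeIdx n} (he : e ∈ S) : e.1.2 ∈ verts S :=
  mem_verts.2 ⟨e, he, Or.inr rfl⟩

lemma verts_mono {S T : Finset (EdgeIdx n)} (h : S ⊆ T) : verts S ⊆ verts T :=
  Finset.biUnion_subset_biUnion_of_subset_left _ h

lemma card_verts_le (S : Finset (EdgeIdx n)) : (verts S).card ≤ 2 * S.card := by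
  rw [mul_comm]
  exact Finset.card_biUnion_le_card_mul _ _ _ fun e _ => Finset.card_le_two

lemma monoProb_nonneg (S : Finset (EdgeIdx n)) : 0 ≤ monoProb L S := by
  unfold monoProb; positivity

lemma monoProb_anti {S T : Finset (EdgeIdx n)} (h : S ⊆ T) : monoProb L T ≤ monoProb L S := by
  unfold monoProb
  gcongr
  intro z hz
  simp only [mem_monoLabellings] at hz ⊢
  exact fun e he => hz e (h he)

lemma monoProb_empty [Nonempty L] : monoProb L (∅ : Finset (EdgeIdx n)) = 1 := by
  have : (monoLabellings L (∅ : Finset (EdgeIdx n))) = Finset.univ := by ext; simp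
  simp [monoProb, this]

/-- Edge sets without common vertex are independent: exchanging two labellings off the vertices
of `S` is a bijection. -/
lemma monoProb_union_of_disjoint [Nonempty L] {S T : Finset (EdgeIdx n)}
    (h : Disjoint (verts S) (verts T)) :
    monoProb L (S ∪ T) = monoProb L S * monoProb L T := by
  have key : (monoLabellings L S ×ˢ monoLabellings L T).card =
      (monoLabellings L (S ∪ T) ×ˢ (Finset.univ : Finset (Fin n → L))).card := by
    let φ : (Fin n → L) × (Fin n → L) → (Fin n → L) × (Fin n → L) := fun z =>
      (fun i => if i ∈ verts S then z.1 i else z.2 i,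
        fun i => if i ∈ verts S then z.2 i else z.1 i)
    have hφ : ∀ z, φ (φ z) = z := by
      intro z
      ext i <;> simp only [φ] <;> split_ifs <;> rfl
    refine Finset.card_nbij' φ φ ?_ ?_ (fun z _ => hφ z) (fun z _ => hφ z)
    · rintro z hz
      simp only [Finset.coe_product, Set.mem_prod, Finset.mem_coe, mem_monoLabellings,
        Finset.mem_univ, and_true, Finset.mem_union] at hz ⊢
      rintro e (he | he)
      · simp only [φ, fst_mem_verts he, snd_mem_verts he, if_true]
        exact hz.1 e he
      · simp only [φ, Finset.disjoint_right.1 h (fst_mem_verts he),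
          Finset.disjoint_right.1 h (snd_mem_verts he), if_false]
        exact hz.2 e he
    · rintro z hz
      simp only [Finset.coe_product, Set.mem_prod, Finset.mem_coe, mem_monoLabellings,
        Finset.mem_univ, and_true, Finset.mem_union] at hz ⊢
      refine ⟨fun e he => ?_, fun e he => ?_⟩
      · simp only [φ, fst_mem_verts he, snd_mem_verts he, if_true]
        exact hz e (Or.inl he)
      · simp only [φ, Finset.disjoint_right.1 h (fst_mem_verts he),
          Finset.disjoint_right.1 h (snd_mem_verts he), if_false]
        exact hz e (Or.inr he)
  rw [Finset.card_product, Finset.card_product, Finset.card_univ, Fintype.card_fun,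
    Fintype.card_fin] at key
  have key' : ((monoLabellings L S).card : ℝ) * (monoLabellings L T).card =
      (monoLabellings L (S ∪ T)).card * (Fintype.card L : ℝ) ^ n := by exact_mod_cast key
  have hL : (Fintype.card L : ℝ) ^ n ≠ 0 := by positivity
  unfold monoProb
  rw [div_mul_div_comm, key', mul_div_mul_right _ _ hL]

/-- The events that the edges of `S`, respectively of `T`, are monochromatic are positively
correlated: for labels in a group they are subgroups. -/
lemma monoProb_mul_le_union [Nonempty L] (S T : Finset (EdgeIdx n)) :
    monoProb L S * monoProb L T ≤ monoProb L (S ∪ T) := by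
  -- Any group structure on the set of labels will do.
  have : NeZero (Fintype.card L) := ⟨Fintype.card_ne_zero⟩
  let _ : AddCommGroup L := ((Fintype.equivFin L).trans (ZMod.finEquiv _).toEquiv).addCommGroup
  let H (U : Finset (EdgeIdx n)) : AddSubgroup (Fin n → L) :=
    { carrier := {z | ∀ e ∈ U, z e.1.1 = z e.1.2}
      zero_mem' := fun e _ => rfl
      add_mem' := fun ha hb e he => congrArg₂ (· + ·) (ha e he) (hb e he)
      neg_mem' := fun ha e he => congrArg Neg.neg (ha e he) }
  have hcard (U) : (monoLabellings L U).card = Nat.card (H U) :=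
    (Nat.subtype_card (monoLabellings L U) fun z => mem_monoLabellings).symm
  have hinf : H (S ∪ T) = H S ⊓ H T := by
    ext z
    refine ⟨fun hz => ⟨fun e he => hz e (Finset.mem_union_left _ he),
      fun e he => hz e (Finset.mem_union_right _ he)⟩, fun hz e he => ?_⟩
    exact (Finset.mem_union.1 he).elim (hz.1 e) (hz.2 e)
  have hG : (Nat.card (Fin n → L) : ℝ) = (Fintype.card L : ℝ) ^ n := by
    rw [Nat.card_eq_fintype_card, Fintype.card_fun, Fintype.card_fin]
    push_cast
    rfl
  have hprob (U) : monoProb L U = 1 / ((H U).index : ℝ) := by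
    have h1 : (Nat.card (H U) : ℝ) * (H U).index = (Fintype.card L : ℝ) ^ n := by
      rw [← hG]; exact_mod_cast (H U).card_mul_index
    have h2 : ((H U).index : ℝ) ≠ 0 := by exact_mod_cast AddSubgroup.index_ne_zero_of_finite
    have h3 : (Nat.card (H U) : ℝ) ≠ 0 := by exact_mod_cast Nat.card_pos.ne'
    unfold monoProb
    rw [hcard, ← h1]
    field_simp
  rw [hprob, hprob, hprob, hinf, one_div_mul_one_div]
  have hpos : 0 < (H S ⊓ H T).index :=
    Nat.pos_of_ne_zero AddSubgroup.index_ne_zero_of_finite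
  refine one_div_le_one_div_of_le (by exact_mod_cast hpos) ?_
  exact_mod_cast AddSubgroup.index_inf_le

/-- Adding an edge with a fresh endpoint divides the probability by the number of labels. -/
lemma monoProb_insert_mul_le {S : Finset (EdgeIdx n)} {e : EdgeIdx n}
    (h : e.1.1 ∉ verts S ∨ e.1.2 ∉ verts S) :
    monoProb L (insert e S) * Fintype.card L ≤ monoProb L S := by
  obtain ⟨v, u, hv, huv, hor⟩ : ∃ v u, v ∉ verts S ∧ u ≠ v ∧
      ∀ z : Fin n → L, z e.1.1 = z e.1.2 → z v = z u := by
    rcases h with h | h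
    · exact ⟨_, e.1.2, h, e.2.ne', fun z hz => hz⟩
    · exact ⟨_, e.1.1, h, e.2.ne, fun z hz => hz.symm⟩
  have key : (monoLabellings L (insert e S) ×ˢ (Finset.univ : Finset L)).card ≤
      (monoLabellings L S).card := by
    refine Finset.card_le_card_of_injOn (fun a => Function.update a.1 v a.2) ?_ ?_
    · rintro ⟨z, t⟩ hz
      simp only [Finset.coe_product, Set.mem_prod, Finset.mem_coe, mem_monoLabellings,
        Finset.mem_univ, and_true] at hz ⊢
      intro f hf
      have h1 : f.1.1 ≠ v := fun h => hv (h ▸ fst_mem_verts hf)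
      have h2 : f.1.2 ≠ v := fun h => hv (h ▸ snd_mem_verts hf)
      rw [Function.update_of_ne h1, Function.update_of_ne h2]
      exact hz f (Finset.mem_insert_of_mem hf)
    · rintro ⟨z, t⟩ hz ⟨z', t'⟩ hz' heq
      simp only [Finset.coe_product, Set.mem_prod, Finset.mem_coe, mem_monoLabellings,
        Finset.mem_univ, and_true] at hz hz' heq
      have hoff : ∀ i, i ≠ v → z i = z' i := fun i hi => by
        simpa [hi] using congrFun heq i
      have ht : t = t' := by simpa using congrFun heq v
      have hz1 := hor z (hz e (Finset.mem_insert_self _ _))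
      have hz1' := hor z' (hz' e (Finset.mem_insert_self _ _))
      refine Prod.ext (funext fun i => ?_) ht
      by_cases hi : i = v
      · change z i = z' i
        rw [hi, hz1, hz1', hoff u huv]
      · exact hoff i hi
  rw [Finset.card_product, Finset.card_univ] at key
  unfold monoProb
  rw [div_mul_eq_mul_div]
  gcongr
  exact_mod_cast key

lemma monoProb_singleton [Nonempty L] (e : EdgeIdx n) :
    monoProb L {e} = 1 / Fintype.card L := by
  have hpos : (0 : ℝ) < Fintype.card L := by exact_mod_cast Fintype.card_pos
  refine le_antisymm ?_ ?_
  · have := monoProb_insert_mul_le (L := L) (S := ∅) (e := e) (Or.inl (by simp [verts]))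
    rw [monoProb_empty] at this
    rw [le_div_iff₀ hpos]
    simpa using this
  · -- Every labelling arises from a monochromatic one by relabelling one endpoint of `e`.
    have key : (Finset.univ : Finset (Fin n → L)).card ≤
        (monoLabellings L {e} ×ˢ (Finset.univ : Finset L)).card := by
      refine Finset.card_le_card_of_injOn
        (fun w => (Function.update w e.1.2 (w e.1.1), w e.1.2)) ?_ ?_
      · intro w _
        simp [Function.update_of_ne e.2.ne]
      · intro w _ w' _ heq
        simp only [Prod.mk.injEq] at heq
        funext i
        by_cases hi : i = e.1.2
        · rw [hi]; exact heq.2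
        · simpa [hi] using congrFun heq.1 i
    rw [Finset.card_product, Finset.card_univ, Finset.card_univ, Fintype.card_fun,
      Fintype.card_fin] at key
    have key' : (Fintype.card L : ℝ) ^ n ≤ (monoLabellings L {e}).card * Fintype.card L := by
      exact_mod_cast key
    unfold monoProb
    rw [div_le_div_iff₀ hpos (by positivity), one_mul]
    exact key'

end Monochromatic

/-! ### Cumulants -/

section Cumulants

variable {n : ℕ} (L : Type*) [Fintype L] [DecidableEq L]

/-- The joint cumulants of the indicator that `e₀` is monochromatic with the indicators of the
edges of `S`, through the recursion
`κ S = 𝔼[X_{e₀} X^S] - ∑_{T ⊂ S} κ T * 𝔼[X^{S \ T}]`. Since the indicators are idempotent,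
`𝔼[X_{e₀} X^S]` is `monoProb L (insert e₀ S)`, also when `e₀ ∈ S`. -/
noncomputable def cumulant (e₀ : EdgeIdx n) (S : Finset (EdgeIdx n)) : ℝ :=
  monoProb L (insert e₀ S) - ∑ T : S.ssubsets, cumulant e₀ T.1 * monoProb L (S \ T.1)
termination_by S.card
decreasing_by exact Finset.card_lt_card (Finset.mem_ssubsets.1 T.2)

variable {L} {e₀ : EdgeIdx n}

lemma cumulant_eq (S : Finset (EdgeIdx n)) :
    cumulant L e₀ S =
      monoProb L (insert e₀ S) - ∑ T ∈ S.ssubsets, cumulant L e₀ T * monoProb L (S \ T) := by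
  rw [cumulant, Finset.sum_coe_sort S.ssubsets fun T => cumulant L e₀ T * monoProb L (S \ T)]

lemma sum_cumulant_mul_monoProb [Nonempty L] (S : Finset (EdgeIdx n)) :
    ∑ T ∈ S.powerset, cumulant L e₀ T * monoProb L (S \ T) = monoProb L (insert e₀ S) := by
  rw [← Finset.insert_erase (Finset.mem_powerset_self S), Finset.sum_insert (by simp),
    cumulant_eq S, Finset.sdiff_self, monoProb_empty, mul_one]
  exact sub_add_cancel _ _

/-- If `S` splits off edges having no vertex in common with the other ones and `e₀`, then its
cumulant vanishes. -/
lemma cumulant_union_eq_zero [Nonempty L] {S₁ S₂ : Finset (EdgeIdx n)}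
    (hd : Disjoint (verts (insert e₀ S₁)) (verts S₂)) (hne : S₂.Nonempty) :
    cumulant L e₀ (S₁ ∪ S₂) = 0 := by
  induction hS : (S₁ ∪ S₂).card using Nat.strong_induction_on generalizing S₁ S₂ with
  | _ c ih =>
  have hd₁ : Disjoint (verts S₁) (verts S₂) :=
    hd.mono_left (verts_mono (Finset.subset_insert _ _))
  have hdis : Disjoint S₁ S₂ := Finset.disjoint_left.2 fun e h₁ h₂ =>
    Finset.disjoint_left.1 hd₁ (fst_mem_verts h₁) (fst_mem_verts h₂)
  have hsub : S₁.powerset ⊆ (S₁ ∪ S₂).ssubsets := by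
    intro T hT
    rw [Finset.mem_powerset] at hT
    rw [Finset.mem_ssubsets]
    refine ⟨hT.trans Finset.subset_union_left, fun h => ?_⟩
    obtain ⟨e, he⟩ := hne
    exact Finset.disjoint_left.1 hdis (hT (h (Finset.mem_union_right _ he))) he
  rw [cumulant_eq, ← Finset.insert_union, monoProb_union_of_disjoint hd,
    ← Finset.sum_subset hsub ?_]
  · have h (T) (hT : T ∈ S₁.powerset) : cumulant L e₀ T * monoProb L ((S₁ ∪ S₂) \ T) =
        cumulant L e₀ T * monoProb L (S₁ \ T) * monoProb L S₂ := by
      rw [Finset.mem_powerset] at hT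
      rw [Finset.union_sdiff_distrib, Finset.sdiff_eq_self_of_disjoint
        (Finset.disjoint_of_subset_left hT hdis).symm, mul_assoc, monoProb_union_of_disjoint]
      exact hd₁.mono_left (verts_mono Finset.sdiff_subset)
    rw [Finset.sum_congr rfl h, ← Finset.sum_mul, sum_cumulant_mul_monoProb, sub_self]
  · intro T hT hT'
    rw [Finset.mem_ssubsets] at hT
    rw [Finset.mem_powerset] at hT'
    have hdec : T = (T ∩ S₁) ∪ (T ∩ S₂) := by
      rw [← Finset.inter_union_distrib_left, Finset.inter_eq_left.2 hT.1]
    have hne' : (T ∩ S₂).Nonempty := by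
      rw [Finset.nonempty_iff_ne_empty]
      intro h
      rw [h, Finset.union_empty] at hdec
      exact hT' (hdec ▸ Finset.inter_subset_right)
    have := ih T.card (hS ▸ Finset.card_lt_card hT) (S₁ := T ∩ S₁) (S₂ := T ∩ S₂)
      (hd.mono (verts_mono (Finset.insert_subset_insert _ Finset.inter_subset_right))
        (verts_mono Finset.inter_subset_right)) hne' (by rw [← hdec])
    rw [hdec, this, zero_mul]

lemma succ_pow_add_one_le {a : ℝ} {l : ℕ} (hl : 1 ≤ l) (ha : 4 * (l : ℝ) ≤ a) :
    (a + 1) ^ l + 1 ≤ 2 * a ^ l := by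
  have hl' : (1 : ℝ) ≤ l := by exact_mod_cast hl
  have ha1 : (0 : ℝ) < a + 1 := by linarith
  have hal : 4 ≤ a ^ l := by
    calc (4 : ℝ) ≤ a := by linarith
      _ = a ^ 1 := (pow_one a).symm
      _ ≤ a ^ l := pow_le_pow_right₀ (by linarith) hl
  -- Bernoulli's inequality for `(a / (a + 1)) ^ l`.
  have hb := one_add_mul_le_pow (a := -1 / (a + 1)) (by rw [le_div_iff₀ ha1]; linarith) l
  have h1 : 1 + -1 / (a + 1) = a / (a + 1) := by field_simp; ring
  have h2 : (3 : ℝ) / 4 ≤ 1 + l * (-1 / (a + 1)) := by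
    have : (l : ℝ) / (a + 1) ≤ 1 / 4 := by rw [div_le_div_iff₀ ha1 (by norm_num)]; linarith
    have h3 : (l : ℝ) * (-1 / (a + 1)) = -(l / (a + 1)) := by ring
    linarith
  rw [h1, div_pow] at hb
  have h4 := (le_div_iff₀ (pow_pos ha1 l)).1 (h2.trans hb)
  linarith

/-- The base `4 D` absorbs the number of terms of the recursion: `∑_{T ⊂ S} a ^ #T` is
`(a + 1) ^ #S - a ^ #S`, which is less than `a ^ #S` when `a ≥ 4 #S`. -/
lemma abs_cumulant_le [Nonempty L] {D : ℕ} (hD : 1 ≤ D) {S : Finset (EdgeIdx n)}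
    (hS : S.card ≤ D) :
    |cumulant L e₀ S| ≤ (4 * D : ℝ) ^ S.card * monoProb L (insert e₀ S) := by
  induction hc : S.card using Nat.strong_induction_on generalizing S with
  | _ c ih =>
  rcases S.eq_empty_or_nonempty with rfl | hne
  · have : c = 0 := by simpa using hc.symm
    subst this
    have h0 : (∅ : Finset (EdgeIdx n)).ssubsets = ∅ := rfl
    rw [cumulant_eq, h0, Finset.sum_empty, sub_zero, abs_of_nonneg (monoProb_nonneg _), pow_zero,
      one_mul]
  have hp := monoProb_nonneg (L := L) (insert e₀ S)
  have hterm (T) (hT : T ∈ S.ssubsets) : |cumulant L e₀ T * monoProb L (S \ T)| ≤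
      (4 * D : ℝ) ^ T.card * monoProb L (insert e₀ S) := by
    rw [Finset.mem_ssubsets] at hT
    have hlt := Finset.card_lt_card hT
    have h1 := ih T.card (hc ▸ hlt) (hlt.le.trans hS) rfl
    rw [abs_mul, abs_of_nonneg (monoProb_nonneg (S \ T))]
    calc _ ≤ (4 * D : ℝ) ^ T.card * monoProb L (insert e₀ T) * monoProb L (S \ T) :=
          mul_le_mul_of_nonneg_right h1 (monoProb_nonneg _)
      _ ≤ _ := by
          rw [mul_assoc]
          refine mul_le_mul_of_nonneg_left ((monoProb_mul_le_union _ _).trans_eq ?_)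
            (by positivity)
          rw [Finset.insert_union, Finset.union_sdiff_of_subset hT.1]
  have hsum : ∑ T ∈ S.ssubsets, (4 * D : ℝ) ^ T.card = (4 * D + 1 : ℝ) ^ c - (4 * D : ℝ) ^ c := by
    have h := Finset.sum_pow_mul_eq_add_pow (4 * D : ℝ) 1 S
    simp only [one_pow, mul_one] at h
    rw [← Finset.insert_erase (Finset.mem_powerset_self S), Finset.sum_insert (by simp)] at h
    rw [← hc, ← h]
    exact (add_sub_cancel_left _ _).symm
  have hbern := succ_pow_add_one_le (a := 4 * D) (l := c) (hc ▸ hne.card_pos)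
    (by have : (c : ℝ) ≤ D := by exact_mod_cast hc ▸ hS
        linarith)
  calc |cumulant L e₀ S|
      ≤ |monoProb L (insert e₀ S)| + |∑ T ∈ S.ssubsets, cumulant L e₀ T * monoProb L (S \ T)| := by
        rw [cumulant_eq]; exact abs_sub _ _
    _ ≤ monoProb L (insert e₀ S) +
          ∑ T ∈ S.ssubsets, (4 * D : ℝ) ^ T.card * monoProb L (insert e₀ S) := by
        rw [abs_of_nonneg hp]
        gcongr
        exact (Finset.abs_sum_le_sum_abs _ _).trans (Finset.sum_le_sum hterm)
    _ = (1 + ((4 * D + 1 : ℝ) ^ c - (4 * D : ℝ) ^ c)) * monoProb L (insert e₀ S) := by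
        rw [← Finset.sum_mul, hsum]; ring
    _ ≤ _ := by
        gcongr
        linarith

variable (e₀) in
/-- The edges outside `S` that have an endpoint in common with `S` or `e₀`. -/
def touching (S : Finset (EdgeIdx n)) : Finset (EdgeIdx n) :=
  {e | e ∉ S ∧ (e.1.1 ∈ verts (insert e₀ S) ∨ e.1.2 ∈ verts (insert e₀ S))}

variable (e₀) in
/-- The sets of `l` edges that can be built edge by edge, each new edge having an endpoint in
common with `e₀` or a previous edge. -/
def grown : ℕ → Finset (Finset (EdgeIdx n))
  | 0 => {∅}
  | l + 1 => ((grown l).sigma (touching e₀)).image fun x => insert x.2 x.1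

lemma card_of_mem_grown {l : ℕ} {S : Finset (EdgeIdx n)} (hS : S ∈ grown e₀ l) : S.card = l := by
  induction l generalizing S with
  | zero => simp_all [grown]
  | succ l ih =>
    simp only [grown, Finset.mem_image, Finset.mem_sigma] at hS
    obtain ⟨⟨T, e⟩, ⟨hT, he⟩, rfl⟩ := hS
    simp only [touching, Finset.mem_filter] at he
    rw [Finset.card_insert_of_notMem he.2.1, ih hT]

/-- If `T` is a largest grown subset of `S`, no edge of `S \ T` touches it, so `S` must be `T` for
the cumulant not to vanish. -/
lemma mem_grown_of_cumulant_ne_zero [Nonempty L] {S : Finset (EdgeIdx n)}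
    (hS : cumulant L e₀ S ≠ 0) : S ∈ grown e₀ S.card := by
  obtain ⟨T, hT, hmax⟩ := Finset.exists_max_image
    (S.powerset.filter fun T => T ∈ grown e₀ T.card) Finset.card ⟨∅, by simp [grown]⟩
  simp only [Finset.mem_filter, Finset.mem_powerset] at hT hmax
  rcases (S \ T).eq_empty_or_nonempty with h | h
  · rw [Finset.sdiff_eq_empty_iff_subset] at h
    exact hT.1.antisymm h ▸ hT.2
  refine absurd ?_ hS
  rw [← Finset.union_sdiff_of_subset hT.1]
  refine cumulant_union_eq_zero ?_ h
  rw [Finset.disjoint_right]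
  intro i hi hi'
  obtain ⟨e, he, hei⟩ := mem_verts.1 hi
  rw [Finset.mem_sdiff] at he
  have hcard := Finset.card_insert_of_notMem he.2
  have := hmax (insert e T) ⟨Finset.insert_subset he.1 hT.1, by
    rw [hcard]
    simp only [grown, Finset.mem_image, Finset.mem_sigma]
    refine ⟨⟨T, e⟩, ⟨hT.2, ?_⟩, rfl⟩
    simp only [touching, Finset.mem_filter, Finset.mem_univ, true_and]
    exact ⟨he.2, hei.imp (fun h' => by rwa [← h']) fun h' => by rwa [← h']⟩⟩
  omega

lemma card_touching_le (S : Finset (EdgeIdx n)) :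
    (touching e₀ S).card ≤ 2 * ((verts (insert e₀ S)).card * n) := by
  have : (touching e₀ S).card ≤ ((verts (insert e₀ S) ×ˢ (Finset.univ : Finset (Fin n))) ∪
      ((Finset.univ : Finset (Fin n)) ×ˢ verts (insert e₀ S))).card := by
    refine Finset.card_le_card_of_injOn Subtype.val ?_ Subtype.val_injective.injOn
    intro e he
    simpa using (Finset.mem_filter.1 he).2.2
  refine this.trans ((Finset.card_union_le _ _).trans_eq ?_)
  simp only [Finset.card_product, Finset.card_univ, Fintype.card_fin]
  ring

/-- An edge touching `S` either brings in a new vertex, for which there are at most `2 v n` choices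
and a factor `(card L)⁻²` is gained, or joins two of the `v` vertices present. -/
lemma sum_touching_le [Nonempty L] (S : Finset (EdgeIdx n)) :
    ∑ e ∈ touching e₀ S, monoProb L (insert e₀ (insert e S)) ^ 2 ≤
      monoProb L (insert e₀ S) ^ 2 * (2 * ((verts (insert e₀ S)).card * n) /
        (Fintype.card L : ℝ) ^ 2 + ((verts (insert e₀ S)).card : ℝ) ^ 2) := by
  have hpos : (0 : ℝ) < Fintype.card L := by exact_mod_cast Fintype.card_pos
  rw [← Finset.sum_filter_add_sum_filter_not (touching e₀ S) fun e =>
    e.1.1 ∉ verts (insert e₀ S) ∨ e.1.2 ∉ verts (insert e₀ S), mul_add]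
  refine add_le_add ?_ ?_
  · refine (Finset.sum_le_card_nsmul _ _
      (monoProb L (insert e₀ S) ^ 2 / (Fintype.card L : ℝ) ^ 2) fun e he => ?_).trans ?_
    · rw [Finset.insert_comm, ← div_pow]
      refine pow_le_pow_left₀ (monoProb_nonneg _) ?_ 2
      rw [le_div_iff₀ hpos]
      exact monoProb_insert_mul_le (Finset.mem_filter.1 he).2
    · rw [nsmul_eq_mul, mul_div_assoc', mul_div_assoc', mul_comm]
      gcongr
      exact_mod_cast (Finset.card_le_card (Finset.filter_subset _ _)).trans (card_touching_le S)
  · refine (Finset.sum_le_card_nsmul _ _ (monoProb L (insert e₀ S) ^ 2) fun e he => ?_).trans ?_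
    · exact pow_le_pow_left₀ (monoProb_nonneg _)
        (monoProb_anti (Finset.insert_subset_insert _ (Finset.subset_insert _ _))) 2
    · rw [nsmul_eq_mul, mul_comm]
      gcongr
      have : _ ≤ (verts (insert e₀ S) ×ˢ verts (insert e₀ S)).card :=
        Finset.card_le_card_of_injOn (s := (touching e₀ S).filter fun e =>
          ¬(e.1.1 ∉ verts (insert e₀ S) ∨ e.1.2 ∉ verts (insert e₀ S))) Subtype.val
          (fun e he => by
            have := (Finset.mem_filter.1 he).2
            push Not at this
            simpa using this) Subtype.val_injective.injOn
      rw [Finset.card_product] at this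
      rw [sq]
      exact_mod_cast this

lemma sum_image_le_sum {ι κ : Type*} [DecidableEq κ] (s : Finset ι) (g : ι → κ) (f : κ → ℝ)
    (hf : ∀ x, 0 ≤ f x) : ∑ x ∈ s.image g, f x ≤ ∑ i ∈ s, f (g i) := by
  classical
  induction s using Finset.induction_on with
  | empty => simp
  | insert a s ha ih =>
    rw [Finset.image_insert, Finset.sum_insert ha]
    refine (?_ : _ ≤ f (g a) + ∑ x ∈ s.image g, f x).trans (by gcongr)
    by_cases h : g a ∈ s.image g
    · rw [Finset.insert_eq_of_mem h]
      linarith [hf (g a)]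
    · rw [Finset.sum_insert h]

lemma sum_grown_le [Nonempty L] {D l : ℕ} (hl : l ≤ D) (hL : Fintype.card L ^ 2 ≤ 2 * n) :
    ∑ S ∈ grown e₀ l, monoProb L (insert e₀ S) ^ 2 ≤
      1 / (Fintype.card L : ℝ) ^ 2 * (12 * D ^ 2 * (n / (Fintype.card L : ℝ) ^ 2)) ^ l := by
  induction l with
  | zero => simp [grown, monoProb_singleton]
  | succ l ih =>
    have hpos : (0 : ℝ) < Fintype.card L := by exact_mod_cast Fintype.card_pos
    have hratio : (1 : ℝ) ≤ 2 * (n / (Fintype.card L : ℝ) ^ 2) := by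
      rw [mul_div_assoc', le_div_iff₀ (by positivity), one_mul]
      exact_mod_cast hL
    rw [pow_succ (12 * (D : ℝ) ^ 2 * _), ← mul_assoc]
    refine (sum_image_le_sum _ _ _ fun _ => sq_nonneg _).trans ?_
    rw [Finset.sum_sigma]
    refine (?_ : _ ≤ ∑ S ∈ grown e₀ l, monoProb L (insert e₀ S) ^ 2 *
      (12 * D ^ 2 * (n / (Fintype.card L : ℝ) ^ 2))).trans ?_
    · refine Finset.sum_le_sum fun S hS => (sum_touching_le S).trans ?_
      gcongr
      have hv : ((verts (insert e₀ S)).card : ℝ) ≤ 2 * D := by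
        have h1 := card_verts_le (insert e₀ S)
        have h2 := Finset.card_insert_le e₀ S
        rw [card_of_mem_grown hS] at h2
        exact_mod_cast (by omega : (verts (insert e₀ S)).card ≤ 2 * D)
      have hD : (1 : ℝ) ≤ D := by exact_mod_cast (by omega : 1 ≤ D)
      set r : ℝ := n / (Fintype.card L : ℝ) ^ 2
      set v : ℝ := ((verts (insert e₀ S)).card : ℝ)
      have hr : 0 ≤ r := by positivity
      have hv0 : 0 ≤ v := by positivity
      have h1 : 2 * (v * n) / (Fintype.card L : ℝ) ^ 2 = 2 * v * r := by
        simp only [r]; ring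
      rw [h1]
      have h2 : 2 * v * r ≤ 4 * D ^ 2 * r := by
        have : 2 * v ≤ 4 * D ^ 2 := by nlinarith
        exact mul_le_mul_of_nonneg_right this hr
      have h3 : v ^ 2 ≤ 4 * D ^ 2 * (2 * r) := by
        calc v ^ 2 ≤ (2 * D) ^ 2 * 1 := by rw [mul_one]; gcongr
          _ ≤ (2 * D) ^ 2 * (2 * r) := by gcongr
          _ = _ := by ring
      linarith
    · rw [← Finset.sum_mul]
      gcongr
      exact ih (by omega)

/-- Summing over the sizes of the edge sets gives a geometric series; the term `S = ∅` alone
contributes the squared mean `(card L)⁻²`. -/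
lemma sum_sq_cumulant_le [Nonempty L] {D : ℕ} (hD : 1 ≤ D) (hL : Fintype.card L ^ 2 ≤ 2 * n)
    {t : ℝ} (ht : t ^ 2 * (192 * D ^ 4 * (n / (Fintype.card L : ℝ) ^ 2)) ≤ 1 / 4) :
    ∑ S with S.card ≤ D, (t ^ S.card * cumulant L e₀ S) ^ 2 ≤
      (4 / 3) / (Fintype.card L : ℝ) ^ 2 := by
  have hpos : (0 : ℝ) < Fintype.card L := by exact_mod_cast Fintype.card_pos
  have hlevel (l) (hl : l ∈ Finset.range (D + 1)) :
      ∑ S ∈ (Finset.univ.filter fun S : Finset (EdgeIdx n) => S.card ≤ D) with S.card = l,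
        (t ^ S.card * cumulant L e₀ S) ^ 2 ≤ 1 / (Fintype.card L : ℝ) ^ 2 * (1 / 4) ^ l := by
    have hlD : l ≤ D := Nat.lt_succ_iff.1 (Finset.mem_range.1 hl)
    rw [← Finset.sum_subset (s₁ := grown e₀ l)]
    · calc ∑ S ∈ grown e₀ l, (t ^ S.card * cumulant L e₀ S) ^ 2
          ≤ ∑ S ∈ grown e₀ l, (t ^ 2 * (16 * D ^ 2)) ^ l * monoProb L (insert e₀ S) ^ 2 := by
            refine Finset.sum_le_sum fun S hS => ?_
            have hc := card_of_mem_grown hS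
            have h := abs_cumulant_le (L := L) (e₀ := e₀) hD (hc ▸ hlD)
            rw [hc] at h
            have h2 := pow_le_pow_left₀ (abs_nonneg _) h 2
            rw [sq_abs] at h2
            calc (t ^ S.card * cumulant L e₀ S) ^ 2
                = (t ^ 2) ^ l * cumulant L e₀ S ^ 2 := by rw [hc, mul_pow]; ring
              _ ≤ (t ^ 2) ^ l * ((4 * D : ℝ) ^ l * monoProb L (insert e₀ S)) ^ 2 := by gcongr
              _ = _ := by
                have h16 : ((4 * D : ℝ) ^ l) ^ 2 = (16 * D ^ 2) ^ l := by
                  rw [pow_right_comm, mul_pow]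
                  norm_num
                rw [mul_pow, mul_pow (t ^ 2), h16, mul_assoc]
        _ ≤ (t ^ 2 * (16 * D ^ 2)) ^ l * (1 / (Fintype.card L : ℝ) ^ 2 *
              (12 * D ^ 2 * (n / (Fintype.card L : ℝ) ^ 2)) ^ l) := by
            rw [← Finset.mul_sum]
            gcongr
            exact sum_grown_le hlD hL
        _ = 1 / (Fintype.card L : ℝ) ^ 2 *
              (t ^ 2 * (192 * D ^ 4 * (n / (Fintype.card L : ℝ) ^ 2))) ^ l := by
            rw [mul_left_comm, ← mul_pow]
            congr 2
            ring
        _ ≤ _ := by gcongr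
    · intro S hS
      have := card_of_mem_grown hS
      simp [this, hlD]
    · intro S hS hS'
      have hc := (Finset.mem_filter.1 hS).2
      have : cumulant L e₀ S = 0 := by
        by_contra h
        exact hS' (hc ▸ mem_grown_of_cumulant_ne_zero h)
      rw [this, mul_zero]
      norm_num
  rw [← Finset.sum_fiberwise_of_maps_to (t := Finset.range (D + 1)) (g := Finset.card)
    (fun S hS => by
      have := (Finset.mem_filter.1 hS).2
      exact Finset.mem_range.2 (by omega))]
  refine (Finset.sum_le_sum hlevel).trans ?_
  have hgeom : ∑ l ∈ Finset.range (D + 1), (1 / 4 : ℝ) ^ l ≤ 4 / 3 := by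
    have : (0 : ℝ) ≤ (1 / 4) ^ (D + 1) := by positivity
    rw [geom_sum_eq (by norm_num), div_le_iff_of_neg (by norm_num)]
    linarith
  rw [← Finset.mul_sum, div_eq_mul_one_div (4 / 3 : ℝ), mul_comm]
  gcongr

end Cumulants

/-! ### Low degree functions on the cube -/

section Cube

variable {E : Type*}

/-- The sign `1` or `-1` encoded by a Boolean. -/
noncomputable def sgn (b : Bool) : ℝ := if b then 1 else -1

lemma sgn_mul_self (b : Bool) : sgn b * sgn b = 1 := by cases b <;> simp [sgn]

/-- The Walsh function of `S`: the product of the signs of the coordinates in `S`. -/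
noncomputable def walsh (S : Finset E) (y : E → Bool) : ℝ := ∏ e ∈ S, sgn (y e)

lemma walsh_eq_prod_univ [Fintype E] [DecidableEq E] (S : Finset E) (y : E → Bool) :
    walsh S y = ∏ e, if e ∈ S then sgn (y e) else 1 := by
  simp [walsh, Finset.prod_ite_mem]

variable (E) in
/-- The functions on the cube of degree at most `D`, spanned by the Walsh functions. -/
noncomputable def lowDegree (D : ℕ) : Submodule ℝ ((E → Bool) → ℝ) :=
  Submodule.span ℝ (walsh '' {S : Finset E | S.card ≤ D})

lemma walsh_mem_lowDegree {S : Finset E} {D : ℕ} (h : S.card ≤ D) : walsh S ∈ lowDegree E D :=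
  Submodule.subset_span ⟨S, h, rfl⟩

lemma lowDegree_mono {d D : ℕ} (h : d ≤ D) : lowDegree E d ≤ lowDegree E D :=
  Submodule.span_mono (Set.image_mono fun _ hS => le_trans hS h)

lemma const_mem_lowDegree (c : ℝ) (D : ℕ) : (fun _ => c) ∈ lowDegree E D := by
  have h := (lowDegree E D).smul_mem c (walsh_mem_lowDegree (S := ∅) (Nat.zero_le D))
  convert h using 1
  ext y
  simp [walsh]

lemma mul_indicator_mem_lowDegree [DecidableEq E] {D : ℕ} {f : (E → Bool) → ℝ}
    (hf : f ∈ lowDegree E D) (e : E) :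
    (fun y => f y * if y e then 1 else 0) ∈ lowDegree E (D + 1) := by
  have hind (b : Bool) : (if b then 1 else 0 : ℝ) = 1 / 2 * (1 + sgn b) := by
    cases b <;> norm_num [sgn]
  induction hf using Submodule.span_induction with
  | mem f hf =>
    obtain ⟨S, hS, rfl⟩ := hf
    have hS : S.card ≤ D := hS
    have h1 := walsh_mem_lowDegree (E := E) (hS.trans D.le_succ)
    have h2 : (fun y => walsh S y * sgn (y e)) ∈ lowDegree E (D + 1) := by
      by_cases he : e ∈ S
      · convert walsh_mem_lowDegree (S := S.erase e) (D := D + 1)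
          ((Finset.card_erase_le).trans (hS.trans D.le_succ)) using 1
        ext y
        rw [walsh, ← Finset.mul_prod_erase S _ he, mul_right_comm, sgn_mul_self, one_mul, walsh]
      · convert walsh_mem_lowDegree (S := insert e S) (D := D + 1)
          ((Finset.card_insert_le _ _).trans (by omega)) using 1
        ext y
        rw [walsh, walsh, Finset.prod_insert he, mul_comm]
    convert (lowDegree E (D + 1)).smul_mem (1 / 2 : ℝ) (add_mem h1 h2) using 1
    ext y
    simp only [hind, Pi.smul_apply, Pi.add_apply, smul_eq_mul]
    ring
  | zero => simpa using const_mem_lowDegree 0 (D + 1)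
  | add f g _ _ hf hg =>
    convert add_mem hf hg using 1
    ext y
    simp only [Pi.add_apply, add_mul]
  | smul a f _ hf =>
    convert (lowDegree E (D + 1)).smul_mem a hf using 1
    ext y
    simp only [Pi.smul_apply, smul_eq_mul, mul_assoc]

lemma eval_adjacency_mem_lowDegree {n D : ℕ} {P : MvPolynomial (Fin n × Fin n) ℝ}
    (hP : P.totalDegree ≤ D) :
    (fun y => MvPolynomial.eval (fun e => adjacency y e.1 e.2) P) ∈
      lowDegree (EdgeIdx n) D := by
  have hentry {d : ℕ} {f : (EdgeIdx n → Bool) → ℝ} (hf : f ∈ lowDegree (EdgeIdx n) d)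
      (i : Fin n × Fin n) : (fun y => f y * adjacency y i.1 i.2) ∈
        lowDegree (EdgeIdx n) (d + 1) := by
    unfold adjacency
    split_ifs with h1 h2
    · exact mul_indicator_mem_lowDegree hf _
    · exact mul_indicator_mem_lowDegree hf _
    · simpa using const_mem_lowDegree 0 (d + 1)
  have hpow {d : ℕ} {f : (EdgeIdx n → Bool) → ℝ} (hf : f ∈ lowDegree (EdgeIdx n) d)
      (i : Fin n × Fin n) (r : ℕ) : (fun y => f y * adjacency y i.1 i.2 ^ r) ∈
        lowDegree (EdgeIdx n) (d + r) := by
    induction r with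
    | zero => simpa using hf
    | succ r ih => simpa only [pow_succ, ← mul_assoc, ← add_assoc] using hentry ih i
  have hmon (s : Finset (Fin n × Fin n)) (m : Fin n × Fin n → ℕ) :
      (fun y => ∏ i ∈ s, adjacency y i.1 i.2 ^ m i) ∈
        lowDegree (EdgeIdx n) (∑ i ∈ s, m i) := by
    induction s using Finset.induction_on with
    | empty => simpa using const_mem_lowDegree 1 0
    | insert i s hi ih =>
      simp only [Finset.prod_insert hi, Finset.sum_insert hi, add_comm (m i)]
      simpa only [mul_comm] using hpow ih i (m i)
  have hsum : (fun y => MvPolynomial.eval (fun e => adjacency y e.1 e.2) P) =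
      ∑ m ∈ P.support, P.coeff m • fun y : EdgeIdx n → Bool =>
        ∏ i ∈ m.support, adjacency y i.1 i.2 ^ m i := by
    ext y
    simp [MvPolynomial.eval_eq]
  rw [hsum]
  exact Submodule.sum_mem _ fun m hm => Submodule.smul_mem _ _
    (lowDegree_mono ((MvPolynomial.le_totalDegree hm).trans hP) (hmon m.support m))

end Cube

/-! ### The coupling -/

section Coupling

variable {E : Type*}

/-- The joint law of a Boolean `y` with sign of mean `lam * x` and a uniform Boolean `s`: with
probability `1 - lam` they are equal, otherwise the sign of `y` is drawn with mean `x`. -/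
noncomputable def coupling (lam x : ℝ) (b : Bool × Bool) : ℝ :=
  1 / 2 * ((1 - lam) * (if b.1 = b.2 then 1 else 0) + lam * ((1 + x * sgn b.1) / 2))

lemma coupling_nonneg {lam x : ℝ} (h0 : 0 ≤ lam) (h1 : lam ≤ 1) (hx0 : 0 ≤ x) (hx1 : x ≤ 1)
    (b : Bool × Bool) : 0 ≤ coupling lam x b := by
  have h2 : 0 ≤ 1 - lam := by linarith
  have h3 : 0 ≤ 1 + x * sgn b.1 := by cases b.1 <;> simp only [sgn] <;> norm_num <;> linarith
  unfold coupling
  positivity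

variable [Fintype E] [DecidableEq E]

/-- Functions in product form are integrated coordinatewise. -/
lemma sum_prod_coupling (lam : ℝ) (x : E → ℝ) (h : E → Bool × Bool → ℝ) :
    ∑ p : E → Bool × Bool, (∏ e, coupling lam (x e) (p e)) * ∏ e, h e (p e) =
      ∏ e, ∑ b, coupling lam (x e) b * h e b := by
  rw [Finset.prod_univ_sum, Fintype.piFinset_univ]
  simp only [Finset.prod_mul_distrib]

lemma sum_coupling_walsh_mul_walsh (lam : ℝ) (x : E → ℝ) (S T : Finset E) :
    ∑ p : E → Bool × Bool, (∏ e, coupling lam (x e) (p e)) *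
        (walsh S (fun e => (p e).1) * walsh T (fun e => (p e).2)) =
      if T ⊆ S then (1 - lam) ^ T.card * (lam ^ (S \ T).card * ∏ e ∈ S \ T, x e) else 0 := by
  simp only [walsh_eq_prod_univ, ← Finset.prod_mul_distrib (f := fun e => ite (e ∈ S) _ _)]
  rw [sum_prod_coupling lam x fun e b =>
    (if e ∈ S then sgn b.1 else 1) * (if e ∈ T then sgn b.2 else 1)]
  have hfac (e) : ∑ b, coupling lam (x e) b *
      ((if e ∈ S then sgn b.1 else 1) * (if e ∈ T then sgn b.2 else 1)) =
      if e ∈ T then (if e ∈ S then 1 - lam else 0) else (if e ∈ S then lam * x e else 1) := by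
    split_ifs <;> simp [Fintype.sum_prod_type, coupling, sgn] <;> ring
  simp only [hfac]
  split_ifs with hTS
  · have h1 : ∀ e, (if e ∈ T then (if e ∈ S then 1 - lam else 0) else
        (if e ∈ S then lam * x e else 1)) =
        (if e ∈ T then 1 - lam else 1) * (if e ∈ S \ T then lam * x e else 1) := by
      intro e
      have := @hTS e
      by_cases h1 : e ∈ T <;> by_cases h2 : e ∈ S <;> simp_all
    simp only [h1, Finset.prod_mul_distrib, Finset.prod_ite_mem, Finset.univ_inter,
      Finset.prod_const]
  · obtain ⟨e, heT, heS⟩ := Finset.not_subset.1 hTS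
    exact Finset.prod_eq_zero (Finset.mem_univ e) (by simp [heT, heS])

lemma sum_coupling_walsh_snd (lam : ℝ) (x : E → ℝ) (S T : Finset E) :
    ∑ p : E → Bool × Bool, (∏ e, coupling lam (x e) (p e)) *
        (walsh S (fun e => (p e).2) * walsh T (fun e => (p e).2)) = if S = T then 1 else 0 := by
  simp only [walsh_eq_prod_univ, ← Finset.prod_mul_distrib (f := fun e => ite (e ∈ S) _ _)]
  rw [sum_prod_coupling lam x fun e b =>
    (if e ∈ S then sgn b.2 else 1) * (if e ∈ T then sgn b.2 else 1)]
  have hfac (e) : ∑ b, coupling lam (x e) b *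
      ((if e ∈ S then sgn b.2 else 1) * (if e ∈ T then sgn b.2 else 1)) =
      if (e ∈ S ↔ e ∈ T) then 1 else 0 := by
    by_cases h1 : e ∈ S <;> by_cases h2 : e ∈ T <;>
      simp [h1, h2, Fintype.sum_prod_type, coupling, sgn] <;> ring
  simp only [hfac]
  split_ifs with hST
  · simp [hST]
  · rw [Finset.ext_iff, not_forall] at hST
    obtain ⟨e, he⟩ := hST
    exact Finset.prod_eq_zero (Finset.mem_univ e) (by simp [he])

lemma sum_coupling_fst (lam : ℝ) (x : E → ℝ) (g : (E → Bool) → ℝ) :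
    ∑ p : E → Bool × Bool, (∏ e, coupling lam (x e) (p e)) * g (fun e => (p e).1) =
      ∑ y : E → Bool, (∏ e, (1 + lam * x e * sgn (y e)) / 2) * g y := by
  rw [← (Equiv.arrowProdEquivProdArrow E (fun _ => Bool) (fun _ => Bool)).symm.sum_comp,
    Fintype.sum_prod_type]
  refine Finset.sum_congr rfl fun y _ => ?_
  simp only [Equiv.arrowProdEquivProdArrow, Equiv.coe_fn_symm_mk]
  rw [← Finset.sum_mul]
  congr 1
  have h := Finset.prod_univ_sum (fun _ : E => (Finset.univ : Finset Bool))
    (fun e s => coupling lam (x e) (y e, s))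
  rw [Fintype.piFinset_univ] at h
  rw [← h]
  refine Finset.prod_congr rfl fun e _ => ?_
  cases y e <;> simp [coupling, sgn] <;> ring

end Coupling

/-! ### The Bayes risk of low degree functions -/

section Bayes

variable {n : ℕ} {L : Type*} [DecidableEq L]

/-- The indicator that the endpoints of `e` have the same label. -/
noncomputable def sameLabel (z : Fin n → L) (e : EdgeIdx n) : ℝ :=
  if z e.1.1 = z e.1.2 then 1 else 0

lemma sameLabel_nonneg (z : Fin n → L) (e : EdgeIdx n) : 0 ≤ sameLabel z e := by
  unfold sameLabel; split_ifs <;> norm_num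

lemma sameLabel_le_one (z : Fin n → L) (e : EdgeIdx n) : sameLabel z e ≤ 1 := by
  unfold sameLabel; split_ifs <;> norm_num

lemma sameLabel_mul_self (z : Fin n → L) (e : EdgeIdx n) :
    sameLabel z e * sameLabel z e = sameLabel z e := by
  unfold sameLabel; split_ifs <;> norm_num

lemma sameLabel_mul_prod (z : Fin n → L) (e₀ : EdgeIdx n) (S : Finset (EdgeIdx n)) :
    sameLabel z e₀ * ∏ e ∈ S, sameLabel z e = ∏ e ∈ insert e₀ S, sameLabel z e := by
  by_cases h : e₀ ∈ S
  · rw [Finset.insert_eq_of_mem h, ← Finset.mul_prod_erase S _ h, ← mul_assoc,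
      sameLabel_mul_self]
  · rw [Finset.prod_insert h]

variable [Fintype L]

lemma sum_prod_sameLabel (S : Finset (EdgeIdx n)) :
    (∑ z : Fin n → L, ∏ e ∈ S, sameLabel z e) / (Fintype.card L : ℝ) ^ n = monoProb L S := by
  simp only [sameLabel, Finset.prod_ite_zero, Finset.prod_const_one, Finset.sum_boole, monoProb,
    monoLabellings]

/-- The expectation when the labels `z` are uniform and, given `z`, the pairs `(y e, s e)` follow
independently the coupling with parameter `sameLabel z e`. -/
noncomputable def jointExp (lam : ℝ)
    (F : (Fin n → L) → (EdgeIdx n → Bool × Bool) → ℝ) : ℝ :=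
  (∑ z, ∑ p, (∏ e, coupling lam (sameLabel z e) (p e)) * F z p) / (Fintype.card L : ℝ) ^ n

variable {lam : ℝ}

lemma jointExp_add (F G : (Fin n → L) → (EdgeIdx n → Bool × Bool) → ℝ) :
    jointExp lam (fun z p => F z p + G z p) = jointExp lam F + jointExp lam G := by
  simp only [jointExp, mul_add, Finset.sum_add_distrib, add_div]

lemma jointExp_const_mul (a : ℝ) (F : (Fin n → L) → (EdgeIdx n → Bool × Bool) → ℝ) :
    jointExp lam (fun z p => a * F z p) = a * jointExp lam F := by
  simp only [jointExp, mul_left_comm _ a, ← Finset.mul_sum, mul_div_assoc]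

lemma jointExp_sum {ι : Type*} (s : Finset ι)
    (F : ι → (Fin n → L) → (EdgeIdx n → Bool × Bool) → ℝ) :
    jointExp lam (fun z p => ∑ i ∈ s, F i z p) = ∑ i ∈ s, jointExp lam (F i) := by
  simp only [jointExp, Finset.mul_sum, ← Finset.sum_div]
  congr 1
  rw [Finset.sum_comm (s := s)]
  refine Finset.sum_congr rfl fun z _ => ?_
  rw [Finset.sum_comm]

lemma jointExp_nonneg (h0 : 0 ≤ lam) (h1 : lam ≤ 1)
    {F : (Fin n → L) → (EdgeIdx n → Bool × Bool) → ℝ} (hF : ∀ z p, 0 ≤ F z p) :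
    0 ≤ jointExp lam F := by
  refine div_nonneg (Finset.sum_nonneg fun z _ => Finset.sum_nonneg fun p _ =>
    mul_nonneg (Finset.prod_nonneg fun e _ => ?_) (hF z p)) (by positivity)
  exact coupling_nonneg h0 h1 (sameLabel_nonneg z e) (sameLabel_le_one z e) _

lemma jointExp_walsh_mul_walsh (S T : Finset (EdgeIdx n)) :
    jointExp (L := L) lam (fun _ p => walsh S (fun e => (p e).1) * walsh T (fun e => (p e).2)) =
      if T ⊆ S then (1 - lam) ^ T.card * (lam ^ (S \ T).card * monoProb L (S \ T)) else 0 := by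
  simp only [jointExp, sum_coupling_walsh_mul_walsh]
  split_ifs with h
  · rw [← Finset.mul_sum, ← Finset.mul_sum, ← sum_prod_sameLabel]
    ring
  · simp

lemma jointExp_walsh_snd [Nonempty L] (S T : Finset (EdgeIdx n)) :
    jointExp (L := L) lam (fun _ p => walsh S (fun e => (p e).2) * walsh T (fun e => (p e).2)) =
      if S = T then 1 else 0 := by
  have : (Fintype.card L : ℝ) ≠ 0 := by exact_mod_cast Fintype.card_ne_zero
  simp only [jointExp, sum_coupling_walsh_snd, Finset.sum_const, Finset.card_univ,
    Fintype.card_fun, Fintype.card_fin, nsmul_eq_mul]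
  push_cast
  field_simp

lemma jointExp_walsh_mul_sameLabel (S : Finset (EdgeIdx n)) (e₀ : EdgeIdx n) :
    jointExp (L := L) lam (fun z p => walsh S (fun e => (p e).1) * sameLabel z e₀) =
      lam ^ S.card * monoProb L (insert e₀ S) := by
  have h (z : Fin n → L) : ∑ p : EdgeIdx n → Bool × Bool,
      (∏ e, coupling lam (sameLabel z e) (p e)) *
        (walsh S (fun e => (p e).1) * sameLabel z e₀) =
      lam ^ S.card * ∏ e ∈ insert e₀ S, sameLabel z e := by
    have := sum_coupling_walsh_mul_walsh lam (sameLabel z) S ∅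
    simp only [walsh, Finset.prod_empty, mul_one, Finset.empty_subset, if_true, Finset.card_empty,
      pow_zero, one_mul, Finset.sdiff_empty] at this
    simp only [← mul_assoc, ← Finset.sum_mul, walsh]
    rw [this, ← sameLabel_mul_prod]
    ring
  simp only [jointExp, h, ← Finset.mul_sum, mul_div_assoc, sum_prod_sameLabel]

lemma jointExp_sameLabel [Nonempty L] (e₀ : EdgeIdx n) :
    jointExp (L := L) lam (fun z _ => sameLabel z e₀) = 1 / Fintype.card L := by
  have := jointExp_walsh_mul_sameLabel (L := L) (lam := lam) ∅ e₀
  simpa [walsh, monoProb_singleton] using this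

/-- The dual certificate: a function of the uniform signs alone that has the same correlation as
`sameLabel z e₀` with each function of degree at most `D` of the data. -/
noncomputable def certificate (L : Type*) [Fintype L] [DecidableEq L] (lam : ℝ) (e₀ : EdgeIdx n)
    (D : ℕ) (s : EdgeIdx n → Bool) : ℝ :=
  ∑ T with T.card ≤ D, (lam / (1 - lam)) ^ T.card * cumulant L e₀ T * walsh T s

/-- On Walsh functions the identity is the recursion defining the cumulants. -/
lemma jointExp_mul_certificate [Nonempty L] (hlam : lam ≠ 1) {D : ℕ} {e₀ : EdgeIdx n}
    {f : (EdgeIdx n → Bool) → ℝ} (hf : f ∈ lowDegree (EdgeIdx n) D) :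
    jointExp (L := L) lam
        (fun _ p => f (fun e => (p e).1) * certificate L lam e₀ D (fun e => (p e).2)) =
      jointExp (L := L) lam (fun z p => f (fun e => (p e).1) * sameLabel z e₀) := by
  have hlam' : 1 - lam ≠ 0 := sub_ne_zero.2 hlam.symm
  induction hf using Submodule.span_induction with
  | mem f hf =>
    obtain ⟨S, hS, rfl⟩ := hf
    have hS : S.card ≤ D := hS
    simp only [certificate, Finset.mul_sum, mul_left_comm (walsh S _)]
    rw [jointExp_sum]
    simp only [jointExp_const_mul, jointExp_walsh_mul_walsh]
    rw [jointExp_walsh_mul_sameLabel, ← sum_cumulant_mul_monoProb, Finset.mul_sum,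
      ← Finset.sum_subset (s₁ := S.powerset)]
    · refine Finset.sum_congr rfl fun T hT => ?_
      have hTS := Finset.mem_powerset.1 hT
      rw [if_pos hTS, Finset.card_sdiff_of_subset hTS,
        ← Nat.add_sub_of_le (Finset.card_le_card hTS), Nat.add_sub_cancel_left, pow_add, div_pow]
      field_simp
    · intro T hT
      simpa using (Finset.card_le_card (Finset.mem_powerset.1 hT)).trans hS
    · intro T _ hT
      rw [if_neg (fun h => hT (Finset.mem_powerset.2 h)), mul_zero]
  | zero => simp [jointExp]
  | add f g _ _ hf hg =>
    simp only [Pi.add_apply, add_mul, jointExp_add, hf, hg]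
  | smul a f _ hf =>
    simp only [Pi.smul_apply, smul_eq_mul, mul_assoc, jointExp_const_mul, hf]

lemma jointExp_certificate_sq [Nonempty L] (e₀ : EdgeIdx n) (D : ℕ) :
    jointExp (L := L) lam (fun _ p => certificate L lam e₀ D (fun e => (p e).2) ^ 2) =
      ∑ T : Finset (EdgeIdx n) with T.card ≤ D,
        ((lam / (1 - lam)) ^ T.card * cumulant L e₀ T) ^ 2 := by
  simp only [certificate, sq, Finset.sum_mul_sum, mul_mul_mul_comm _ (walsh _ _)]
  rw [jointExp_sum]
  refine Finset.sum_congr rfl fun S hS => ?_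
  rw [jointExp_sum]
  simp only [jointExp_const_mul, jointExp_walsh_snd, mul_ite, mul_one, mul_zero,
    Finset.sum_ite_eq, hS, if_true]

/-- The Bayes risk for estimating `sameLabel z e₀` is at least its second moment minus the squared
norm of the certificate. -/
theorem bayes_risk_ge [Nonempty L] {D : ℕ} (hD : 1 ≤ D) (hL2 : 2 ≤ Fintype.card L)
    (hL : Fintype.card L ^ 2 ≤ 2 * n) (h0 : 0 ≤ lam) (h1 : lam ≤ 1 / 2)
    (hlam : lam ^ 2 * (3072 * D ^ 4 * (n / (Fintype.card L : ℝ) ^ 2)) ≤ 1) (e₀ : EdgeIdx n)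
    {f : (EdgeIdx n → Bool) → ℝ} (hf : f ∈ lowDegree (EdgeIdx n) D) :
    1 / (3 * Fintype.card L : ℝ) ≤
      (∑ z : Fin n → L, ∑ y : EdgeIdx n → Bool,
        (∏ e, (1 + lam * sameLabel z e * sgn (y e)) / 2) * (f y - sameLabel z e₀) ^ 2) /
          (Fintype.card L : ℝ) ^ n := by
  have hm : (2 : ℝ) ≤ Fintype.card L := by exact_mod_cast hL2
  have hexp : (∑ z : Fin n → L, ∑ y : EdgeIdx n → Bool,
        (∏ e, (1 + lam * sameLabel z e * sgn (y e)) / 2) * (f y - sameLabel z e₀) ^ 2) /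
          (Fintype.card L : ℝ) ^ n =
      jointExp (L := L) lam fun z p => (f (fun e => (p e).1) - sameLabel z e₀) ^ 2 := by
    unfold jointExp
    congr 1
    refine Finset.sum_congr rfl fun z _ => ?_
    rw [sum_coupling_fst lam (sameLabel z) fun y => (f y - sameLabel z e₀) ^ 2]
  set W := certificate L lam e₀ D with hW
  have hsplit : jointExp (L := L) lam (fun z p => (f (fun e => (p e).1) - sameLabel z e₀) ^ 2) +
      jointExp (L := L) lam (fun _ p => W (fun e => (p e).2) ^ 2) =
      jointExp (L := L) lam (fun _ p => (f (fun e => (p e).1) - W (fun e => (p e).2)) ^ 2) +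
        jointExp (L := L) lam (fun z _ => sameLabel z e₀) := by
    have h := jointExp_mul_certificate (L := L) (lam := lam) (by linarith) (e₀ := e₀) hf
    have h2 : jointExp (L := L) lam (fun z p => (f (fun e => (p e).1) - sameLabel z e₀) ^ 2 +
          W (fun e => (p e).2) ^ 2 + 2 * (f (fun e => (p e).1) * sameLabel z e₀)) =
        jointExp (L := L) lam (fun z p => (f (fun e => (p e).1) - W (fun e => (p e).2)) ^ 2 +
          sameLabel z e₀ + 2 * (f (fun e => (p e).1) * W (fun e => (p e).2))) := by
      congr 1
      ext z p
      linear_combination sameLabel_mul_self z e₀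
    simp only [jointExp_add, jointExp_const_mul] at h2
    linarith
  have hpos : 0 ≤ jointExp (L := L) lam
      (fun _ p => (f (fun e => (p e).1) - W (fun e => (p e).2)) ^ 2) :=
    jointExp_nonneg h0 (by linarith) fun _ _ => sq_nonneg _
  have hcert : jointExp (L := L) lam (fun _ p => W (fun e => (p e).2) ^ 2) ≤
      (4 / 3) / (Fintype.card L : ℝ) ^ 2 := by
    rw [hW, jointExp_certificate_sq]
    refine sum_sq_cumulant_le hD hL ?_
    have ht : (lam / (1 - lam)) ^ 2 ≤ 4 * lam ^ 2 := by
      rw [div_pow, div_le_iff₀ (by nlinarith)]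
      have h : 1 ≤ 4 * (1 - lam) ^ 2 := by nlinarith
      nlinarith [mul_le_mul_of_nonneg_left h (sq_nonneg lam)]
    calc _ ≤ 4 * lam ^ 2 * (192 * D ^ 4 * (n / (Fintype.card L : ℝ) ^ 2)) := by gcongr
      _ = lam ^ 2 * (3072 * D ^ 4 * (n / (Fintype.card L : ℝ) ^ 2)) / 4 := by ring
      _ ≤ 1 / 4 := by gcongr
  rw [jointExp_sameLabel] at hsplit
  have hfin : 1 / (3 * Fintype.card L : ℝ) + (4 / 3) / (Fintype.card L : ℝ) ^ 2 ≤
      1 / Fintype.card L := by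
    rw [div_add_div _ _ (by positivity) (by positivity), div_le_div_iff₀ (by positivity)
      (by positivity)]
    have hm0 : (0 : ℝ) < (Fintype.card L : ℝ) ^ 2 := by positivity
    nlinarith
  rw [hexp]
  linarith

end Bayes

/-! ### From the Bayes risk to the minimax risk -/

section Minimax

variable {n k m D : ℕ}

lemma choose_two_eq_card_edgeIdx (n : ℕ) : n.choose 2 = Fintype.card (EdgeIdx n) := by
  have h (j : Fin n) : ∑ i : Fin n, (if i < j then 1 else 0) = (j : ℕ) := by
    rw [← Finset.card_filter, ← Fin.card_Iio]
    congr 1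
    ext i
    simp
  rw [Fintype.card_subtype, Finset.card_filter, Fintype.sum_prod_type, Finset.sum_comm]
  simp only [h]
  rw [Fin.sum_univ_eq_sum_range (fun i => i), Finset.sum_range_id, Nat.choose_two_right]

lemma bernoulli_weight_nonneg (q : unitInterval) (b : Bool) :
    0 ≤ (1 + (2 * (q : ℝ) - 1) * sgn b) / 2 := by
  have h0 := q.2.1
  have h1 := q.2.2
  cases b <;> simp only [sgn] <;> norm_num <;> linarith

/-- The Bernoulli weights, written through the mean `2 q - 1` of the sign as in the coupling. -/
lemma edgeLaw_singleton (M : Matrix (Fin n) (Fin n) unitInterval) (y : EdgeIdx n → Bool) :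
    edgeLaw M {y} =
      ENNReal.ofReal (∏ e, (1 + (2 * (M e.1.1 e.1.2 : ℝ) - 1) * sgn (y e)) / 2) := by
  have hb (q : unitInterval) (b : Bool) : bernoulliMeasure true false q {b} =
      ENNReal.ofReal ((1 + (2 * (q : ℝ) - 1) * sgn b) / 2) := by
    rw [← ofReal_measureReal, bernoulliMeasure_real_apply _ (measurableSet_singleton b)]
    congr 1
    cases b
    · simp [sgn]
      ring
    · simp [sgn]
  rw [edgeLaw, Measure.pi_singleton, ENNReal.ofReal_prod_of_nonneg fun e _ => bernoulli_weight_nonneg _ _]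
  exact Finset.prod_congr rfl fun e _ => hb _ _

lemma loss_nonneg (A : Matrix (Fin n) (Fin n) ℝ) (M : Matrix (Fin n) (Fin n) unitInterval) :
    0 ≤ loss A M :=
  mul_nonneg (by positivity) (Finset.sum_nonneg fun _ _ => sq_nonneg _)

lemma risk_eq (P : Matrix (Fin n) (Fin n) (MvPolynomial (Fin n × Fin n) ℝ))
    (M : Matrix (Fin n) (Fin n) unitInterval) :
    risk P M = ENNReal.ofReal (∑ y : EdgeIdx n → Bool,
      (∏ e, (1 + (2 * (M e.1.1 e.1.2 : ℝ) - 1) * sgn (y e)) / 2) *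
        loss (evalEstimator P (adjacency y)) M) := by
  rw [risk, lintegral_fintype, ENNReal.ofReal_sum_of_nonneg]
  · refine Finset.sum_congr rfl fun y _ => ?_
    rw [edgeLaw_singleton, mul_comm, ENNReal.ofReal_mul]
    exact Finset.prod_nonneg fun e _ => bernoulli_weight_nonneg _ _
  · exact fun y _ => mul_nonneg (Finset.prod_nonneg fun e _ => bernoulli_weight_nonneg _ _) (loss_nonneg _ _)

/-- The assortative model: vertices with the same label are connected with probability
`(1 + lam) / 2`, the other ones with probability `1 / 2`. -/
noncomputable def assortative (lam : unitInterval) (z : Fin n → Fin m) :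
    Matrix (Fin n) (Fin n) unitInterval := fun i j =>
  if i = j then 0
  else if z i = z j then ⟨(1 + lam) / 2, by have := lam.2.1; positivity, by
    have := lam.2.2; linarith⟩
  else ⟨1 / 2, by norm_num, by norm_num⟩

lemma assortative_mem_sbmClass (hmk : m ≤ k) (lam : unitInterval) (z : Fin n → Fin m) :
    assortative lam z ∈ sbmClass n k := by
  refine ⟨fun i => by simp [assortative], fun a b => if a = b then ⟨(1 + lam) / 2, by
    have := lam.2.1; positivity, by have := lam.2.2; linarith⟩ else
    ⟨1 / 2, by norm_num, by norm_num⟩, fun i => Fin.castLE hmk (z i), ?_, fun i j hij => ?_⟩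
  · refine Matrix.IsSymm.ext fun a b => ?_
    by_cases h : a = b
    · rw [h]
    · rw [if_neg h, if_neg (Ne.symm h)]
  · simp [assortative, hij]

lemma assortative_apply (lam : unitInterval) (z : Fin n → Fin m) (e : EdgeIdx n) :
    (assortative lam z e.1.1 e.1.2 : ℝ) = (1 + lam * sameLabel z e) / 2 := by
  unfold assortative sameLabel
  rw [if_neg e.2.ne]
  split_ifs <;> simp

/-- Since the average over the labels is large, so is the risk for some labels. -/
lemma exists_risk_ge (hn : 2 ≤ n) (hm : 2 ≤ m) (hD : 1 ≤ D) (hmn : m ^ 2 ≤ 2 * n)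
    (lam : unitInterval) (h0 : 0 < (lam : ℝ)) (h1 : (lam : ℝ) ≤ 1 / 2)
    (hlam : (lam : ℝ) ^ 2 * (3072 * D ^ 4 * (n / (m : ℝ) ^ 2)) ≤ 1)
    {P : Matrix (Fin n) (Fin n) (MvPolynomial (Fin n × Fin n) ℝ)} (hP : P ∈ polyEstimators n D) :
    ∃ z : Fin n → Fin m,
      ENNReal.ofReal ((lam : ℝ) ^ 2 / (12 * m)) ≤ risk P (assortative lam z) := by
  have : NeZero m := ⟨by omega⟩
  have hmpos : (0 : ℝ) < m := by exact_mod_cast (by omega : 0 < m)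
  have hN : (0 : ℝ) < n.choose 2 := by exact_mod_cast Nat.choose_pos hn
  -- The density of the data given the labels.
  let w (z : Fin n → Fin m) (y : EdgeIdx n → Bool) : ℝ :=
    ∏ e, (1 + lam * sameLabel z e * sgn (y e)) / 2
  have hrisk (z : Fin n → Fin m) : risk P (assortative lam z) =
      ENNReal.ofReal (∑ y, w z y * loss (evalEstimator P (adjacency y)) (assortative lam z)) := by
    rw [risk_eq]
    congr 1
    refine Finset.sum_congr rfl fun y _ => ?_
    congr 1
    refine Finset.prod_congr rfl fun e _ => ?_
    rw [assortative_apply]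
    ring
  simp only [hrisk]
  have hentry (e : EdgeIdx n) : (m : ℝ) ^ n * ((lam : ℝ) ^ 2 / (12 * m)) ≤
      ∑ z, ∑ y, w z y * (evalEstimator P (adjacency y) e.1.1 e.1.2 -
        (assortative lam z e.1.1 e.1.2 : ℝ)) ^ 2 := by
    let f (y : EdgeIdx n → Bool) : ℝ :=
      (2 / (lam : ℝ)) * evalEstimator P (adjacency y) e.1.1 e.1.2 + -(1 / (lam : ℝ))
    have hf : f ∈ lowDegree (EdgeIdx n) D :=
      add_mem (Submodule.smul_mem _ (2 / (lam : ℝ)) (eval_adjacency_mem_lowDegree (hP _ _)))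
        (const_mem_lowDegree _ D)
    have h := bayes_risk_ge (L := Fin m) hD (by simpa using hm) (by simpa using hmn) h0.le h1
      (by simpa using hlam) e hf
    rw [Fintype.card_fin, le_div_iff₀ (by positivity)] at h
    calc (m : ℝ) ^ n * ((lam : ℝ) ^ 2 / (12 * m))
        = (lam : ℝ) ^ 2 / 4 * (1 / (3 * m) * m ^ n) := by field_simp; norm_num
      _ ≤ (lam : ℝ) ^ 2 / 4 * ∑ z, ∑ y, w z y * (f y - sameLabel z e) ^ 2 := by gcongr
      _ = _ := by
        simp only [Finset.mul_sum]
        refine Finset.sum_congr rfl fun z _ => Finset.sum_congr rfl fun y _ => ?_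
        rw [assortative_apply]
        simp only [f]
        field_simp
        ring
  obtain ⟨z, -, hz⟩ := Finset.exists_le_of_sum_le (s := (Finset.univ : Finset (Fin n → Fin m)))
    (f := fun _ => (lam : ℝ) ^ 2 / (12 * m))
    (g := fun z => ∑ y, w z y * loss (evalEstimator P (adjacency y)) (assortative lam z))
    Finset.univ_nonempty (by
      have hswap : ∑ z, ∑ y, w z y * loss (evalEstimator P (adjacency y)) (assortative lam z) =
          1 / (n.choose 2 : ℝ) * ∑ e : EdgeIdx n, ∑ z, ∑ y, w z y *
            (evalEstimator P (adjacency y) e.1.1 e.1.2 -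
              (assortative lam z e.1.1 e.1.2 : ℝ)) ^ 2 := by
        rw [Finset.sum_comm (s := (Finset.univ : Finset (EdgeIdx n))), Finset.mul_sum]
        refine Finset.sum_congr rfl fun z _ => ?_
        rw [Finset.sum_comm, Finset.mul_sum]
        refine Finset.sum_congr rfl fun y _ => ?_
        rw [loss, ← Finset.mul_sum, mul_left_comm]
      rw [hswap, Finset.sum_const, Finset.card_univ, Fintype.card_fun, Fintype.card_fin,
        Fintype.card_fin, nsmul_eq_mul, one_div, le_inv_mul_iff₀ hN, choose_two_eq_card_edgeIdx]
      push_cast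
      rw [← nsmul_eq_mul, ← Finset.card_univ]
      exact Finset.card_nsmul_le_sum _ _ _ fun e _ => hentry e)
  exact ⟨z, ENNReal.ofReal_le_ofReal hz⟩

/-- The lower bound given by the assortative models with `m ≤ k` labels, for the largest `lam`
permitted by `bayes_risk_ge`. -/
theorem lowDegreeMinimaxRisk_ge (hn : 2 ≤ n) (hm : 2 ≤ m) (hmk : m ≤ k) (hD : 1 ≤ D)
    (hmn : m ^ 2 ≤ 2 * n) :
    ENNReal.ofReal (m / (36864 * n * D ^ 4)) ≤ lowDegreeMinimaxRisk n k D := by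
  have hmpos : (0 : ℝ) < m := by exact_mod_cast (by omega : 0 < m)
  have hnpos : (0 : ℝ) < n := by exact_mod_cast (by omega : 0 < n)
  have hDpos : (1 : ℝ) ≤ D := by exact_mod_cast hD
  have hmn' : (m : ℝ) ^ 2 ≤ 2 * n := by exact_mod_cast hmn
  set l : ℝ := √((m : ℝ) ^ 2 / (3072 * n * D ^ 4)) with hl
  have hl2 : l ^ 2 = (m : ℝ) ^ 2 / (3072 * n * D ^ 4) := Real.sq_sqrt (by positivity)
  have hlpos : 0 < l := Real.sqrt_pos.2 (by positivity)
  have hlhalf : l ≤ 1 / 2 := by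
    refine abs_le_of_sq_le_sq' ?_ (by norm_num) |>.2
    rw [hl2, div_le_iff₀ (by positivity)]
    have : (n : ℝ) ≤ n * D ^ 4 := le_mul_of_one_le_right hnpos.le (one_le_pow₀ hDpos)
    linarith
  let lam : unitInterval := ⟨l, hlpos.le, by linarith⟩
  refine le_iInf₂ fun P hP => ?_
  obtain ⟨z, hz⟩ := exists_risk_ge hn hm hD hmn lam hlpos hlhalf
    (by change l ^ 2 * _ ≤ 1; rw [hl2]; apply le_of_eq; field_simp) hP
  refine le_trans (le_of_eq ?_) (hz.trans (le_iSup₂ (f := fun M _ => risk P M) _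
    (assortative_mem_sbmClass hmk lam z)))
  change _ = ENNReal.ofReal (l ^ 2 / (12 * m))
  rw [hl2]
  congr 1
  field_simp
  norm_num

end Minimax

end Graphon

theorem corollary1 :
    ∃ c : ℝ, 0 < c ∧ ∀ n k D : ℕ, 2 ≤ n → 2 ≤ k → 1 ≤ D →
      ENNReal.ofReal (c / (D : ℝ) ^ 4 * min ((k : ℝ) / n) (1 / k)) ≤
          Graphon.lowDegreeMinimaxRisk n k D ∧
      ((k : ℝ) ≤ √(n : ℝ) →
        ENNReal.ofReal (c * k / (n * (D : ℝ) ^ 4)) ≤ Graphon.lowDegreeMinimaxRisk n k D) := by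
  refine ⟨1 / 73728, by norm_num, fun n k D hn hk hD => ?_⟩
  have hkpos : (0 : ℝ) < k := by exact_mod_cast (by omega : 0 < k)
  have hnpos : (0 : ℝ) < n := by exact_mod_cast (by omega : 0 < n)
  have hDpos : (0 : ℝ) < D := by exact_mod_cast hD
  refine ⟨?_, fun hkn => ?_⟩
  · -- For `k` above `√(2 n)` the bound is the one for about `√n` communities.
    obtain ⟨m, hm, hmk, hmn, hratio⟩ : ∃ m : ℕ, 2 ≤ m ∧ m ≤ k ∧ m ^ 2 ≤ 2 * n ∧
        min ((k : ℝ) / n) (1 / k) ≤ 2 * (m / n) := by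
      by_cases hkn : k ^ 2 ≤ 2 * n
      · refine ⟨k, hk, le_rfl, hkn, (min_le_left _ _).trans ?_⟩
        have : (0 : ℝ) ≤ k / n := by positivity
        linarith
      · have hs1 := Nat.sqrt_le' n
        have hs2 := Nat.lt_succ_sqrt' n
        rw [Nat.succ_eq_add_one] at hs2
        push Not at hkn
        refine ⟨max 2 (Nat.sqrt n), le_max_left _ _, max_le hk ?_, ?_, ?_⟩
        · by_contra h
          push Not at h
          nlinarith
        · rcases max_cases 2 (Nat.sqrt n) with ⟨h, -⟩ | ⟨h, -⟩ <;> rw [h] <;> omega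
        · set m := max 2 (Nat.sqrt n)
          have hsm : Nat.sqrt n + 1 ≤ 2 * m := by omega
          have hmn : n < (2 * m) ^ 2 := hs2.trans_le (Nat.pow_le_pow_left hsm 2)
          have hfin : n ≤ 2 * m * k := by
            by_contra h
            push Not at h
            nlinarith
          refine (min_le_right _ _).trans ?_
          rw [mul_div_assoc', div_le_div_iff₀ hkpos hnpos, one_mul]
          exact_mod_cast hfin
    refine le_trans (ENNReal.ofReal_le_ofReal ?_)
      (Graphon.lowDegreeMinimaxRisk_ge hn hm hmk hD hmn)
    calc 1 / 73728 / (D : ℝ) ^ 4 * min ((k : ℝ) / n) (1 / k)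
        ≤ 1 / 73728 / (D : ℝ) ^ 4 * (2 * (m / n)) := by gcongr
      _ = (m : ℝ) / (36864 * n * D ^ 4) := by field_simp; norm_num
  · have hkn' : k ^ 2 ≤ 2 * n := by
      have := (Real.le_sqrt' hkpos).1 hkn
      have h2 : k ^ 2 ≤ n := by exact_mod_cast this
      omega
    refine le_trans (ENNReal.ofReal_le_ofReal ?_)
      (Graphon.lowDegreeMinimaxRisk_ge hn hk le_rfl hD hkn')
    calc 1 / 73728 * (k : ℝ) / (n * D ^ 4) = 1 / 2 * ((k : ℝ) / (36864 * n * D ^ 4)) := by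
          field_simp; norm_num
      _ ≤ (k : ℝ) / (36864 * n * D ^ 4) := by
          have : (0 : ℝ) ≤ (k : ℝ) / (36864 * n * D ^ 4) := by positivity
          linarith
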